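/- Let $\mathbf R$ be a Hermitian positive semidefinite complex $n\times n$ matrix (the spatial correlation matrix), let $\boldsymbol\Phi=\mathrm{diag}(e^{\mathrm i\theta_1},\dots,e^{\mathrm i\theta_n})$ with deterministic real phases $\theta_\ell$, and put $\mathbf A=\mathbf R^{1/2}\boldsymbol\Phi\mathbf R^{1/2}$ and $\mathbf C=\mathbf A\mathbf A^{\mathsf H}$. Let $\mathbf g_{\mathrm u},\mathbf g_{\mathrm f}$ be independent random vectors, each with the circularly symmetric complex Gaussian law $\mathcal{CN}(\mathbf 0,\mathbf I_n)$ (independent coordinates, whose real and imaginary parts are independent real Gaussians of mean $0$ and variance $1/2$), and let $G_0=|\mathbf g_{\mathrm u}^{\mathsf H}\mathbf A\,\mathbf g_{\mathrm f}|^2$. Let $\lambda_1,\dots,\lambda_q$ be the distinct strictly positive eigenvalues of $\mathbf C$, assume $q\ge 1$ (that is, $\mathbf C\neq 0$), and assume that each $\lambda_i$ has multiplicity one. (The eigenvalue $0$ may have any multiplicity.) For $x>0$ let $K_\nu(x)=\int_0^\infty e^{-x\cosh t}\cosh(\nu t)\,dt$ be the modified Bessel function of the second kind. The $K$-distribution with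 shape $k>0$ and scale $\lambda>0$ is the law on $(0,\infty)$ with density $$f_K(k,\lambda,g)=\frac{2\lambda^{-(k+1)/2}}{\Gamma(k)}\,g^{(k-1)/2}K_{k-1}\!\left(2\sqrt{g/\lambda}\right),\qquad g>0,$$ and one writes $$F_K(k,\lambda,g)=1-\frac{2}{\Gamma(k)}\left(\frac g\lambda\right)^{k/2}K_k\!\left(2\sqrt{g/\lambda}\right),\qquad g>0.$$ Set $c_{i,1}=\prod_{j\ne i}\frac{\lambda_i}{\lambda_i-\lambda_j}$ for $1\le i\le q$. Then: 1. $\sum_{i=1}^q c_{i,1}=1$. 2. For every $i$, the $K$-distribution with shape $1$ and scale $\lambda_i$ is a probability law whose cumulative distribution function at $g>0$ is $F_K(1,\lambda_i,g)$, and for $g>0$ $$f_K(1,\lambda_i,g)=\frac{2}{\lambda_i}K_0\!\left(2\sqrt{g/\lambda_i}\right),\qquad F_K(1,\lambda_i,g)=1-2\sqrt{g/\lambda_i}\,K_1\!\left(2\sqrt{g/\lambda_i}\right).$$ 3. The law of $G_0$ is the linear combination, with the (possibly negative) weights $c_{i,1}$, of the $K$-distributions with shape $1$ and scales $\lambda_i$.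 It is absolutely continuous and carried by $(0,\infty)$, with density $f_{G_0}(g)=\sum_{i=1}^q c_{i,1}\,f_K(1,\lambda_i,g)\ge 0$ for $g>0$. 4. The cumulative distribution function of $G_0$ is $F_{G_0}(g)=\sum_{i=1}^q c_{i,1}\,F_K(1,\lambda_i,g)$ for $g>0$, and $F_{G_0}(g)=0$ for $g\le 0$. -/

import Mathlib

open MeasureTheory ProbabilityTheory Set
open scoped Matrix MatrixOrder ComplexOrder

/-- The modified Bessel function of the second kind `K_ν(x)`, through the integral
`∫₀^∞ exp (-x cosh t) cosh (ν t) dt`, which converges for `x > 0`. It is only used at `x > 0`. -/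
noncomputable def besselK (ν x : ℝ) : ℝ :=
  ∫ t in Ioi (0 : ℝ), Real.exp (-x * Real.cosh t) * Real.cosh (ν * t)

/-- The density, at `g > 0`, of the `K`-distribution with shape `k` and scale `lam`. -/
noncomputable def kPDF (k lam g : ℝ) : ℝ :=
  2 * lam ^ (-((k + 1) / 2)) / Real.Gamma k * g ^ ((k - 1) / 2) *
    besselK (k - 1) (2 * Real.sqrt (g / lam))

/-- The closed form, at `g > 0`, of the distribution function of the `K`-distribution with
shape `k` and scale `lam`. -/
noncomputable def kCDF (k lam g : ℝ) : ℝ :=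
  1 - 2 / Real.Gamma k * (g / lam) ^ (k / 2) * besselK k (2 * Real.sqrt (g / lam))

/-- The `K`-distribution with shape `k` and scale `lam`: the measure carried by `(0, ∞)` with
density `kPDF k lam`. -/
noncomputable def kDistribution (k lam : ℝ) : Measure ℝ :=
  (volume.restrict (Ioi 0)).withDensity (fun g => ENNReal.ofReal (kPDF k lam g))

/-- The circularly symmetric complex Gaussian law `𝒞𝒩(0, 1)`: the real and imaginary parts are
independent real Gaussians with mean `0` and variance `1 / 2`. -/
noncomputable def complexGaussian : Measure ℂ :=
  ((gaussianReal 0 (1 / 2)).prod (gaussianReal 0 (1 / 2))).map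
    Complex.measurableEquivRealProd.symm

/-- The law `𝒞𝒩(0, I)` on `ℂ^ι`: independent `𝒞𝒩(0, 1)` coordinates. -/
noncomputable def complexGaussianVec (ι : Type*) [Fintype ι] : Measure (ι → ℂ) :=
  Measure.pi (fun _ => complexGaussian)

/-- The reflection matrix `Φ = diag (exp (i θ_ℓ))`. -/
noncomputable def phaseMatrix {ι : Type*} [DecidableEq ι] (θ : ι → ℝ) : Matrix ι ι ℂ :=
  Matrix.diagonal (fun l => Complex.exp (Complex.I * (θ l : ℂ)))

/-- The composite coupling matrix `A = R^{1/2} Φ R^{1/2}`, with the positive semidefinite square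
root of the correlation matrix `R`. -/
noncomputable def couplingMatrix {ι : Type*} [Fintype ι] [DecidableEq ι]
    (R : Matrix ι ι ℂ) (θ : ι → ℝ) : Matrix ι ι ℂ :=
  CFC.sqrt R * phaseMatrix θ * CFC.sqrt R

/-- The matrix `C = A Aᴴ`. -/
noncomputable def compositeMatrix {ι : Type*} [Fintype ι] [DecidableEq ι]
    (R : Matrix ι ι ℂ) (θ : ι → ℝ) : Matrix ι ι ℂ :=
  couplingMatrix R θ * (couplingMatrix R θ)ᴴ

/-- The channel gain `|uᴴ A v|²`. -/
noncomputable def channelGain {ι : Type*} [Fintype ι] (A : Matrix ι ι ℂ) (u v : ι → ℂ) : ℝ :=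
  ‖star u ⬝ᵥ (A *ᵥ v)‖ ^ 2

/-- The multiplicity of the real number `x` as an eigenvalue of the matrix `C` (the dimension of
the eigenspace). -/
noncomputable def eigenMultiplicity {ι : Type*} [Fintype ι] [DecidableEq ι]
    (C : Matrix ι ι ℂ) (x : ℝ) : ℕ :=
  Module.finrank ℂ (Module.End.eigenspace (Matrix.toLin' C) (x : ℂ))

/-- The weight `c_{i,1} = ∏_{j ≠ i} λ_i / (λ_i - λ_j)`. -/
noncomputable def mixWeight {q : ℕ} (lam : Fin q → ℝ) (i : Fin q) : ℝ :=
  ∏ j ∈ Finset.univ.erase i, lam i / (lam i - lam j)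

/-! The argument compares laws on `ℂ`, before the squared modulus is taken. Given `u`, the value `uᴴ
A v` is circular Gaussian with variance `uᴴ C u`. Diagonalising `C` and using unitary invariance,
the average over `u` gives the characteristic function `∏ⱼ 1 / (1 + ‖t‖² dⱼ / 4)`, with `dⱼ` the
eigenvalues of `C` (`charFun_bilinear`). Zero eigenvalues contribute a factor one and positive ones
are simple, so partial fractions (`prod_one_div_eq_sum`) turn the product into `∑ᵢ cᵢ / (1 + ‖t‖² λᵢ
/ 4)`. Each term is the characteristic function of `√λᵢ z₁ z₂` with `z₁, z₂` independent standard
complex Gaussians, so uniqueness gives a signed mixture of laws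
(`measureReal_eq_of_charFun_eq_sum`). Under `‖·‖²` each component becomes `λᵢ` times a product of
two independent standard exponentials, whose law is the shape-one `K`-distribution
(`map_prod_stdExp`). -/

instance : IsProbabilityMeasure complexGaussian :=
  Measure.isProbabilityMeasure_map (by fun_prop)

instance {ι : Type*} [Fintype ι] : IsProbabilityMeasure (complexGaussianVec ι) := by
  unfold complexGaussianVec; infer_instance

/-! ### Transforms of the scalar complex Gaussian -/

lemma charFun_complexGaussian (t : ℂ) :
    charFun complexGaussian t = Complex.exp (-((‖t‖ ^ 2 / 4 : ℝ) : ℂ)) := by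
  have h (p : ℝ × ℝ) :
      Complex.exp ((inner ℝ (Complex.measurableEquivRealProd.symm p) t : ℝ) * Complex.I) =
      Complex.exp ((t.re : ℂ) * p.1 * Complex.I) * Complex.exp ((t.im : ℂ) * p.2 * Complex.I) := by
    rw [← Complex.exp_add, Complex.inner, Complex.mul_re]
    simp [Complex.measurableEquivRealProd]
    ring_nf
  rw [charFun_apply, complexGaussian, integral_map_equiv]
  simp_rw [h]
  rw [integral_prod_mul (fun x : ℝ => Complex.exp ((t.re : ℂ) * x * Complex.I))
    (fun x : ℝ => Complex.exp ((t.im : ℂ) * x * Complex.I)), ← charFun_apply_real,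
    ← charFun_apply_real, charFun_gaussianReal, charFun_gaussianReal, ← Complex.exp_add,
    Complex.sq_norm, Complex.normSq_apply]
  congr 1
  push_cast
  ring

lemma integral_gaussianReal_cexp_sq {b : ℂ} (hb : -1 < b.re) :
    ∫ x, Complex.exp (-b * (x : ℂ) ^ 2) ∂(gaussianReal 0 (1 / 2)) =
      (Real.sqrt Real.pi : ℂ)⁻¹ * (Real.pi / (1 + b)) ^ (1 / 2 : ℂ) := by
  rw [integral_gaussianReal_eq_integral_smul (by norm_num),
    ← integral_gaussian_complex (b := 1 + b) (by simpa using by linarith),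
    ← integral_const_mul]
  refine integral_congr_ae (.of_forall fun x => ?_)
  simp only [gaussianPDFReal, Complex.real_smul]
  push_cast
  have h2 : (2 : ℝ) * Real.pi * (1 / 2) = Real.pi := by ring
  rw [h2, mul_assoc, ← Complex.exp_add]
  congr 2
  ring

/-- Used with imaginary `b` to identify the law of `‖z‖²`, and with real `b ≥ 0` to average
conditional characteristic functions. -/
lemma integral_complexGaussian_cexp_normSq {b : ℂ} (hb : -1 < b.re) :
    ∫ z, Complex.exp (-b * ((‖z‖ ^ 2 : ℝ) : ℂ)) ∂complexGaussian = 1 / (1 + b) := by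
  have h (p : ℝ × ℝ) :
      Complex.exp (-b * ((‖Complex.measurableEquivRealProd.symm p‖ ^ 2 : ℝ) : ℂ)) =
      Complex.exp (-b * (p.1 : ℂ) ^ 2) * Complex.exp (-b * (p.2 : ℂ) ^ 2) := by
    rw [← Complex.exp_add, Complex.sq_norm, Complex.normSq_apply]
    simp [Complex.measurableEquivRealProd]
    ring_nf
  have hb0 : 1 + b ≠ 0 := by
    intro h0
    have := congrArg Complex.re h0
    simp at this
    linarith
  rw [complexGaussian, integral_map_equiv]
  simp_rw [h]
  rw [integral_prod_mul (fun x : ℝ => Complex.exp (-b * (x : ℂ) ^ 2))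
    (fun x : ℝ => Complex.exp (-b * (x : ℂ) ^ 2)), integral_gaussianReal_cexp_sq hb,
    -- The two equal principal square roots multiply to a first power, so no choice of branch
    -- remains.
    mul_mul_mul_comm, ← Complex.cpow_add _ _ (by simp [hb0, Real.pi_ne_zero]),
    ← mul_inv, ← Complex.ofReal_mul, Real.mul_self_sqrt Real.pi_pos.le]
  norm_num
  have := Real.pi_ne_zero
  field_simp

/-! ### The exponential law of the squared modulus -/

/-- The exponential law with mean one. -/
noncomputable def stdExp : Measure ℝ :=
  (volume.restrict (Ioi 0)).withDensity (fun x => ENNReal.ofReal (Real.exp (-x)))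

lemma lintegral_stdExp {f : ℝ → ENNReal} (hf : Measurable f) :
    ∫⁻ x, f x ∂stdExp = ∫⁻ x in Ioi (0 : ℝ), ENNReal.ofReal (Real.exp (-x)) * f x :=
  lintegral_withDensity_eq_lintegral_mul _ (by fun_prop) hf

instance : IsProbabilityMeasure stdExp := by
  constructor
  rw [stdExp, withDensity_apply _ MeasurableSet.univ, Measure.restrict_univ,
    ← ofReal_integral_eq_lintegral_ofReal (integrableOn_exp_neg_Ioi 0)
      (.of_forall fun x => (Real.exp_pos _).le), integral_exp_neg_Ioi_zero]
  simp

lemma integral_stdExp_cexp {b : ℂ} (hb : -1 < b.re) :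
    ∫ x, Complex.exp (-b * (x : ℂ)) ∂stdExp = 1 / (1 + b) := by
  rw [stdExp, integral_withDensity_eq_integral_toReal_smul (by fun_prop) (by simp)]
  have h (x : ℝ) : (ENNReal.ofReal (Real.exp (-x))).toReal • Complex.exp (-b * (x : ℂ)) =
      Complex.exp (-(1 + b) * x) := by
    rw [ENNReal.toReal_ofReal (Real.exp_pos _).le, Complex.real_smul, Complex.ofReal_exp,
      ← Complex.exp_add]
    congr 1
    push_cast
    ring
  simp_rw [h]
  rw [integral_exp_mul_complex_Ioi (by simp; linarith)]
  simp [neg_div_neg_eq, add_comm, -neg_add_rev]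

lemma map_normSq_complexGaussian : complexGaussian.map (fun z => ‖z‖ ^ 2) = stdExp := by
  have : IsProbabilityMeasure (complexGaussian.map (fun z => ‖z‖ ^ 2)) :=
    Measure.isProbabilityMeasure_map (by fun_prop)
  refine Measure.ext_of_charFun (funext fun t => ?_)
  rw [charFun_apply_real, charFun_apply_real,
    integral_map (by fun_prop) (by fun_prop)]
  have h (x : ℝ) : (t : ℂ) * x * Complex.I = -(-(t * Complex.I)) * x := by ring
  simp_rw [h]
  rw [integral_complexGaussian_cexp_normSq (by simp), integral_stdExp_cexp (by simp)]

/-! ### Gaussian vectors: linear forms, unitary invariance, quadratic forms -/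

lemma integral_complexGaussianVec_cexp_inner {ι : Type*} [Fintype ι] (w : ι → ℂ) (t : ℂ) :
    ∫ v, Complex.exp ((inner ℝ (w ⬝ᵥ v) t : ℝ) * Complex.I) ∂complexGaussianVec ι =
      Complex.exp (-((‖t‖ ^ 2 / 4 * ∑ j, ‖w j‖ ^ 2 : ℝ) : ℂ)) := by
  have h (v : ι → ℂ) : Complex.exp ((inner ℝ (w ⬝ᵥ v) t : ℝ) * Complex.I) =
      ∏ j, Complex.exp ((inner ℝ (v j) (star (w j) * t) : ℝ) * Complex.I) := by
    rw [← Complex.exp_sum, ← Finset.sum_mul, ← Complex.ofReal_sum, dotProduct, sum_inner]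
    congr 4 with j
    simp [Complex.inner, mul_comm, mul_left_comm]
  simp_rw [h]
  rw [complexGaussianVec,
    integral_fintype_prod_eq_prod
      (fun j (z : ℂ) => Complex.exp ((inner ℝ z (star (w j) * t) : ℝ) * Complex.I))]
  simp_rw [← charFun_apply, charFun_complexGaussian, ← Complex.exp_sum, Finset.sum_neg_distrib,
    ← Complex.ofReal_sum, Finset.mul_sum]
  congr 4 with j
  simp only [norm_mul, norm_star]
  ring

lemma ofReal_sum_norm_sq {ι : Type*} [Fintype ι] (w : ι → ℂ) :
    ((∑ j, ‖w j‖ ^ 2 : ℝ) : ℂ) = w ⬝ᵥ star w := by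
  simp [dotProduct, Complex.mul_conj']

/-- `ι → ℂ` carries the sup norm, not an inner product, so laws on it are compared through
`charFunDual`. A real-linear functional is the real part of a complex-linear one, fixed by its
values at `eⱼ` and `i eⱼ`. -/
lemma strongDual_pi_eq_inner {ι : Type*} [Fintype ι] [DecidableEq ι]
    (L : StrongDual ℝ (ι → ℂ)) (v : ι → ℂ) :
    L v = inner ℝ ((fun j => (L (Pi.single j 1) : ℂ) - L (Pi.single j Complex.I) * Complex.I) ⬝ᵥ v)
      (1 : ℂ) := by
  rw [dotProduct, sum_inner, ← L.sum_comp_single]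
  refine Finset.sum_congr rfl fun j _ => ?_
  have : v j = (v j).re • (1 : ℂ) + (v j).im • Complex.I := by
    simp [Complex.re_add_im]
  conv_lhs => rw [this, map_add, map_smul, map_smul]
  simp [Complex.inner]
  ring

/-- The transform at the functional with coefficient vector `w` depends only on `∑ ‖wⱼ‖²`, which `w
↦ w U` preserves. -/
lemma map_mulVec_complexGaussianVec {ι : Type*} [Fintype ι] [DecidableEq ι]
    {U : Matrix ι ι ℂ} (hU : U * Uᴴ = 1) :
    (complexGaussianVec ι).map (fun v => U *ᵥ v) = complexGaussianVec ι := by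
  have hm : Measurable (fun v : ι → ℂ => U *ᵥ v) :=
    (Continuous.matrix_mulVec continuous_const continuous_id).measurable
  have : IsProbabilityMeasure ((complexGaussianVec ι).map (fun v => U *ᵥ v)) :=
    Measure.isProbabilityMeasure_map hm.aemeasurable
  refine Measure.ext_of_charFunDual (funext fun L => ?_)
  rw [charFunDual_apply, charFunDual_apply, integral_map hm.aemeasurable (by fun_prop)]
  obtain ⟨w, hw⟩ : ∃ w : ι → ℂ, ∀ v, L v = inner ℝ (w ⬝ᵥ v) (1 : ℂ) :=
    ⟨_, strongDual_pi_eq_inner L⟩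
  have e (V : Matrix ι ι ℂ) : ∫ v, Complex.exp ((L (V *ᵥ v) : ℝ) * Complex.I)
      ∂complexGaussianVec ι =
      Complex.exp (-((‖(1 : ℂ)‖ ^ 2 / 4 * ∑ j, ‖(w ᵥ* V) j‖ ^ 2 : ℝ) : ℂ)) := by
    rw [← integral_complexGaussianVec_cexp_inner]
    refine integral_congr_ae (.of_forall fun v => ?_)
    beta_reduce
    rw [hw, Matrix.dotProduct_mulVec]
  have e1 := e 1
  simp only [Matrix.one_mulVec, Matrix.vecMul_one] at e1
  refine (e U).trans (Eq.trans ?_ e1.symm)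
  have hn : ∑ j, ‖(w ᵥ* U) j‖ ^ 2 = ∑ j, ‖w j‖ ^ 2 := by
    rw [← Complex.ofReal_inj, ofReal_sum_norm_sq, ofReal_sum_norm_sq, Matrix.star_vecMul,
      ← Matrix.dotProduct_mulVec, Matrix.mulVec_mulVec, hU, Matrix.one_mulVec]
  rw [hn]

lemma integral_complexGaussianVec_cexp_quadratic {ι : Type*} [Fintype ι] {d : ι → ℝ}
    (hd : ∀ j, 0 ≤ d j) {s : ℝ} (hs : 0 ≤ s) :
    ∫ w, Complex.exp (-((s * ∑ j, d j * ‖w j‖ ^ 2 : ℝ) : ℂ)) ∂complexGaussianVec ι =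
      ∏ j, (1 / (1 + (s * d j : ℝ)) : ℂ) := by
  have h (w : ι → ℂ) : Complex.exp (-((s * ∑ j, d j * ‖w j‖ ^ 2 : ℝ) : ℂ)) =
      ∏ j, Complex.exp (-((s * d j : ℝ) : ℂ) * ((‖w j‖ ^ 2 : ℝ) : ℂ)) := by
    rw [← Complex.exp_sum]
    congr 1
    push_cast
    rw [Finset.mul_sum, ← Finset.sum_neg_distrib]
    exact Finset.sum_congr rfl fun j _ => by ring
  simp_rw [h]
  rw [complexGaussianVec, integral_fintype_prod_eq_prod
      (fun j (z : ℂ) => Complex.exp (-((s * d j : ℝ) : ℂ) * ((‖z‖ ^ 2 : ℝ) : ℂ)))]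
  refine Finset.prod_congr rfl fun j _ => integral_complexGaussian_cexp_normSq ?_
  rw [Complex.ofReal_re]
  linarith [mul_nonneg hs (hd j)]

lemma sum_norm_sq_star_vecMul {ι : Type*} [Fintype ι] [DecidableEq ι] {A : Matrix ι ι ℂ}
    (hC : (A * Aᴴ).IsHermitian) (u : ι → ℂ) :
    ∑ j, ‖(star u ᵥ* A) j‖ ^ 2 = ∑ j, hC.eigenvalues j *
      ‖((hC.eigenvectorUnitary : Matrix ι ι ℂ)ᴴ *ᵥ u) j‖ ^ 2 := by
  set U := (hC.eigenvectorUnitary : Matrix ι ι ℂ) with hU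
  rw [← Complex.ofReal_inj, ofReal_sum_norm_sq, Matrix.star_vecMul, star_star,
    ← Matrix.dotProduct_mulVec, Matrix.mulVec_mulVec]
  have h : (A * Aᴴ) *ᵥ u =
      U *ᵥ (Matrix.diagonal (fun j => (hC.eigenvalues j : ℂ)) *ᵥ (Uᴴ *ᵥ u)) := by
    conv_lhs => rw [hC.spectral_theorem, Unitary.conjStarAlgAut_apply]
    rw [Matrix.mulVec_mulVec, Matrix.mulVec_mulVec]
    simp [hU, Matrix.star_eq_conjTranspose, Function.comp_def, mul_assoc]
  rw [h, Matrix.dotProduct_mulVec, ← Matrix.conjTranspose_conjTranspose U, ← Matrix.star_mulVec,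
    Matrix.conjTranspose_conjTranspose]
  simp only [dotProduct, Matrix.mulVec_diagonal, Pi.star_apply, Complex.ofReal_sum]
  refine Finset.sum_congr rfl fun j _ => ?_
  rw [mul_left_comm, mul_comm (star _), RCLike.star_def, Complex.mul_conj']
  push_cast
  rfl

/-! ### Characteristic functions of the bilinear form and of the scaled product -/

lemma continuous_bilinear {ι : Type*} [Fintype ι] (A : Matrix ι ι ℂ) :
    Continuous (fun p : (ι → ℂ) × (ι → ℂ) => star p.1 ⬝ᵥ (A *ᵥ p.2)) :=
  (continuous_star.comp continuous_fst).dotProduct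
    (continuous_const.matrix_mulVec continuous_snd)

lemma charFun_bilinear {ι : Type*} [Fintype ι] [DecidableEq ι] {A : Matrix ι ι ℂ}
    (hC : (A * Aᴴ).IsHermitian) (hd : ∀ j, 0 ≤ hC.eigenvalues j) (t : ℂ) :
    charFun (((complexGaussianVec ι).prod (complexGaussianVec ι)).map
      (fun p => star p.1 ⬝ᵥ (A *ᵥ p.2))) t =
      ∏ j, (1 / (1 + (‖t‖ ^ 2 / 4 * hC.eigenvalues j : ℝ)) : ℂ) := by
  have hm := (continuous_bilinear A).measurable
  have hme : Measurable fun p : (ι → ℂ) × (ι → ℂ) =>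
      Complex.exp ((inner ℝ (star p.1 ⬝ᵥ (A *ᵥ p.2)) t : ℝ) * Complex.I) := by
    have := continuous_bilinear A
    fun_prop
  rw [charFun_apply, integral_map hm.aemeasurable (by fun_prop), integral_prod]
  · simp_rw [Matrix.dotProduct_mulVec, integral_complexGaussianVec_cexp_inner,
      sum_norm_sq_star_vecMul hC]
    have hUm : Measurable
        (fun v : ι → ℂ => (hC.eigenvectorUnitary : Matrix ι ι ℂ)ᴴ *ᵥ v) :=
      (Continuous.matrix_mulVec continuous_const continuous_id).measurable
    rw [← integral_complexGaussianVec_cexp_quadratic hd (by positivity)]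
    -- `Uᴴ u` has the law of `u`, so the diagonalised form may be averaged in its own coordinates.
    conv_rhs => rw [← map_mulVec_complexGaussianVec
      (U := (hC.eigenvectorUnitary : Matrix ι ι ℂ)ᴴ) (by
        rw [Matrix.conjTranspose_conjTranspose, ← Matrix.star_eq_conjTranspose]
        exact Unitary.coe_star_mul_self _)]
    rw [integral_map hUm.aemeasurable (Measurable.aestronglyMeasurable (by measurability))]
  · refine Integrable.of_bound hme.aestronglyMeasurable 1 (.of_forall fun p => ?_)
    rw [Complex.norm_exp_ofReal_mul_I]

/-- The one-eigenvalue model: given the first factor `x`, the product is circular Gaussian with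
variance `l ‖x‖²`. -/
lemma charFun_scaled_product {l : ℝ} (hl : 0 < l) (t : ℂ) :
    charFun ((complexGaussian.prod complexGaussian).map
      (fun p => (Real.sqrt l : ℂ) * (p.1 * p.2))) t =
      1 / (1 + (‖t‖ ^ 2 / 4 * l : ℝ) : ℂ) := by
  rw [charFun_apply, integral_map (by fun_prop) (by fun_prop), integral_prod]
  · have h (x y : ℂ) : (inner ℝ ((Real.sqrt l : ℂ) * (x * y)) t : ℝ) =
        inner ℝ y (star ((Real.sqrt l : ℂ) * x) * t) := by
      simp [Complex.inner]
      ring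
    simp_rw [h, ← charFun_apply, charFun_complexGaussian]
    rw [← integral_complexGaussian_cexp_normSq (b := (‖t‖ ^ 2 / 4 * l : ℝ))]
    · refine integral_congr_ae (.of_forall fun z => ?_)
      simp only [norm_mul, norm_star, Complex.norm_real, Real.norm_eq_abs, mul_pow, sq_abs,
        Real.sq_sqrt hl.le]
      congr 1
      push_cast
      ring
    · rw [Complex.ofReal_re]
      have : 0 ≤ ‖t‖ ^ 2 / 4 * l := by positivity
      linarith
  · refine Integrable.of_bound (by fun_prop) 1 (.of_forall fun p => ?_)
    rw [Complex.norm_exp_ofReal_mul_I]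

/-! ### Partial fractions -/

/-- The Lagrange basis sums to one. With nodes `1 / λᵢ` and evaluation point `-x`, its factors are
`λᵢ (1 + x λⱼ) / (λᵢ - λⱼ)`. The case `x = 0` is the normalisation of the weights. -/
lemma sum_weight_mul_prod {q : ℕ} (hq : 0 < q) {lam : Fin q → ℝ} (hinj : Function.Injective lam)
    (hpos : ∀ i, 0 < lam i) (x : ℝ) :
    ∑ i, mixWeight lam i * ∏ j ∈ Finset.univ.erase i, (1 + x * lam j) = 1 := by
  have : NeZero q := ⟨hq.ne'⟩
  have h := congrArg (Polynomial.eval (-x)) (Lagrange.sum_basis (s := Finset.univ)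
    (v := fun i => (lam i)⁻¹) (fun i _ j _ hij => hinj (inv_injective hij))
    Finset.univ_nonempty)
  rw [Polynomial.eval_finsetSum, Polynomial.eval_one] at h
  refine Eq.trans ?_ h
  refine Finset.sum_congr rfl fun i _ => ?_
  rw [mixWeight, ← Finset.prod_mul_distrib, Lagrange.basis, Polynomial.eval_prod]
  refine Finset.prod_congr rfl fun j hj => ?_
  have hij : lam i - lam j ≠ 0 := sub_ne_zero.2 fun e => (Finset.mem_erase.1 hj).1 (hinj e).symm
  have hji : lam j - lam i ≠ 0 := sub_ne_zero.2 fun e => (Finset.mem_erase.1 hj).1 (hinj e)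
  have hi := (hpos i).ne'
  have hj' := (hpos j).ne'
  have e : (lam i)⁻¹ - (lam j)⁻¹ = (lam j - lam i) / (lam i * lam j) := by
    field_simp
  simp only [Lagrange.basisDivisor, Polynomial.eval_mul, Polynomial.eval_C, Polynomial.eval_sub,
    Polynomial.eval_X, e]
  field_simp
  ring

lemma prod_one_div_eq_sum {q : ℕ} (hq : 0 < q) {lam : Fin q → ℝ} (hinj : Function.Injective lam)
    (hpos : ∀ i, 0 < lam i) {x : ℝ} (hx : 0 ≤ x) :
    ∏ i, 1 / (1 + x * lam i) = ∑ i, mixWeight lam i * (1 / (1 + x * lam i)) := by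
  have hne (i) : 1 + x * lam i ≠ 0 := by
    have := mul_nonneg hx (hpos i).le
    positivity
  rw [Finset.prod_div_distrib, Finset.prod_const_one, div_eq_iff (Finset.prod_ne_zero_iff.2
    fun i _ => hne i), Finset.sum_mul]
  refine (sum_weight_mul_prod hq hinj hpos x).symm.trans ?_
  refine Finset.sum_congr rfl fun i _ => ?_
  rw [← Finset.mul_prod_erase _ _ (Finset.mem_univ i)]
  have := hne i
  field_simp

/-! ### Uniqueness for signed mixtures -/

lemma measureReal_eq_of_charFun_eq_sum {E κ : Type*} [NormedAddCommGroup E]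
    [InnerProductSpace ℝ E] [CompleteSpace E] [MeasurableSpace E] [BorelSpace E]
    [SecondCountableTopology E] [Fintype κ] {μ : Measure E} [IsFiniteMeasure μ]
    {ν : κ → Measure E} [∀ i, IsFiniteMeasure (ν i)] {c : κ → ℝ}
    (h : ∀ t, charFun μ t = ∑ i, (c i : ℂ) * charFun (ν i) t) (s : Set E) :
    μ.real s = ∑ i, c i * (ν i).real s := by
  have hi (ρ : Measure E) [IsFiniteMeasure ρ] (t : E) :
      Integrable (fun x => Complex.exp ((inner ℝ x t : ℝ) * Complex.I)) ρ := by
    refine Integrable.of_bound (by fun_prop) 1 (.of_forall fun p => ?_)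
    rw [Complex.norm_exp_ofReal_mul_I]
  -- Moving the negative weights to the left makes both sides finite measures, to which uniqueness
  -- applies.
  have key : μ + ∑ i, (-c i).toNNReal • ν i = ∑ i, (c i).toNNReal • ν i := by
    refine Measure.ext_of_charFun (funext fun t => ?_)
    rw [charFun_apply, charFun_apply, integral_add_measure (hi _ t) (hi _ t),
      integral_finsetSum_measure fun i _ => hi _ t, integral_finsetSum_measure fun i _ => hi _ t]
    simp_rw [integral_smul_nnreal_measure, ← charFun_apply, h, ← Finset.sum_add_distrib]
    refine Finset.sum_congr rfl fun i _ => ?_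
    rw [NNReal.smul_def, NNReal.smul_def, Complex.real_smul, Complex.real_smul, ← add_mul,
      ← Complex.ofReal_add]
    congr 2
    have := max_zero_sub_max_neg_zero_eq_self (c i)
    simp only [Real.coe_toNNReal']
    linarith
  have hsum (a : κ → NNReal) :
      (∑ i, a i • ν i : Measure E).real s = ∑ i, (a i : ℝ) * (ν i).real s := by
    rw [measureReal_def, Measure.finsetSum_apply, ENNReal.toReal_sum fun i _ => measure_ne_top _ _]
    exact Finset.sum_congr rfl fun i _ => measureReal_nnreal_smul_apply ..
  have k2 := congrArg (fun ρ : Measure E => ρ.real s) key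
  beta_reduce at k2
  rw [measureReal_add_apply, hsum, hsum] at k2
  simp only [Real.coe_toNNReal'] at k2
  rw [eq_sub_of_add_eq k2, ← Finset.sum_sub_distrib]
  refine Finset.sum_congr rfl fun i _ => ?_
  rw [← sub_mul, max_zero_sub_max_neg_zero_eq_self]

/-! ### Bessel integrals through the substitution `x = √a eᵗ` -/

lemma range_const_mul_exp {c : ℝ} (hc : 0 < c) :
    (fun t => c * Real.exp t) '' univ = Ioi 0 := by
  ext x
  simp only [image_univ, mem_range, mem_Ioi]
  constructor
  · rintro ⟨t, rfl⟩
    positivity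
  · intro hx
    exact ⟨Real.log (x / c), by rw [Real.exp_log (by positivity)]; field_simp⟩

lemma injOn_const_mul_exp {c : ℝ} (hc : 0 < c) : InjOn (fun t => c * Real.exp t) univ :=
  fun _ _ _ _ h => Real.exp_injective (mul_left_cancel₀ hc.ne' h)

lemma integral_Ioi_eq_integral_comp_mul_exp {c : ℝ} (hc : 0 < c) (f : ℝ → ℝ) :
    ∫ x in Ioi 0, f x = ∫ t, c * Real.exp t * f (c * Real.exp t) := by
  rw [← range_const_mul_exp hc, integral_image_eq_integral_abs_deriv_smul MeasurableSet.univ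
    (fun x _ => ((Real.hasDerivAt_exp x).const_mul c).hasDerivWithinAt) (injOn_const_mul_exp hc)]
  simp [abs_of_pos (mul_pos hc (Real.exp_pos _))]

lemma integrable_comp_mul_exp {c : ℝ} (hc : 0 < c) {f : ℝ → ℝ} (hf : IntegrableOn f (Ioi 0)) :
    Integrable (fun t => c * Real.exp t * f (c * Real.exp t)) := by
  rw [← range_const_mul_exp hc, integrableOn_image_iff_integrableOn_abs_deriv_smul
    MeasurableSet.univ (fun x _ => ((Real.hasDerivAt_exp x).const_mul c).hasDerivWithinAt)
    (injOn_const_mul_exp hc)] at hf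
  simpa [abs_of_pos (mul_pos hc (Real.exp_pos _))] using hf

lemma exp_neg_sub_div_sqrt_mul_exp {a : ℝ} (ha : 0 < a) (t : ℝ) :
    Real.exp (-(Real.sqrt a * Real.exp t) - a / (Real.sqrt a * Real.exp t)) =
      Real.exp (-(2 * Real.sqrt a) * Real.cosh t) := by
  congr 1
  have hs : 0 < Real.sqrt a := Real.sqrt_pos.2 ha
  have h : a / (Real.sqrt a * Real.exp t) = Real.sqrt a * Real.exp (-t) := by
    rw [Real.exp_neg]
    field_simp
    rw [Real.sq_sqrt ha.le]
  rw [h, Real.cosh_eq]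
  ring

lemma integrableOn_exp_neg_sub_div {a : ℝ} (ha : 0 < a) :
    IntegrableOn (fun x => Real.exp (-x - a / x)) (Ioi 0) := by
  refine (integrableOn_exp_neg_Ioi 0).mono' (by fun_prop) ?_
  filter_upwards [ae_restrict_mem measurableSet_Ioi] with x hx
  rw [Real.norm_eq_abs, Real.abs_exp]
  exact Real.exp_le_exp.2 (sub_le_self _ (div_pos ha hx).le)

/-- From `1 + y ≤ eʸ`. Uniformity in `a ≥ b` is what dominated convergence needs for continuity of
the density. -/
lemma exp_neg_sub_div_div_le {a b x : ℝ} (hb : 0 < b) (hab : b ≤ a) (hx : 0 < x) :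
    Real.exp (-x - a / x) / x ≤ Real.exp (-x) * b⁻¹ := by
  have h1 : Real.exp (-(a / x)) ≤ x / b := by
    rw [Real.exp_neg, inv_le_comm₀ (Real.exp_pos _) (by positivity), inv_div]
    have := Real.add_one_le_exp (a / x)
    have h2 : b / x ≤ a / x := by gcongr
    linarith
  rw [sub_eq_add_neg, Real.exp_add, div_le_iff₀ hx]
  calc Real.exp (-x) * Real.exp (-(a / x)) ≤ Real.exp (-x) * (x / b) := by gcongr
    _ = Real.exp (-x) * b⁻¹ * x := by ring

lemma integrableOn_exp_neg_sub_div_div {a : ℝ} (ha : 0 < a) :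
    IntegrableOn (fun x => Real.exp (-x - a / x) / x) (Ioi 0) := by
  refine ((integrableOn_exp_neg_Ioi 0).mul_const a⁻¹).mono'
    (Measurable.aestronglyMeasurable (by fun_prop)) ?_
  filter_upwards [ae_restrict_mem measurableSet_Ioi] with x hx
  have hx' : 0 < x := hx
  rw [Real.norm_eq_abs, abs_of_nonneg (by positivity)]
  exact exp_neg_sub_div_div_le ha le_rfl hx

lemma integral_exp_neg_sub_div_div {a : ℝ} (ha : 0 < a) :
    ∫ x in Ioi 0, Real.exp (-x - a / x) / x = 2 * besselK 0 (2 * Real.sqrt a) := by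
  have hs : 0 < Real.sqrt a := Real.sqrt_pos.2 ha
  rw [integral_Ioi_eq_integral_comp_mul_exp hs, besselK, ← integral_comp_abs
    (f := fun t => Real.exp (-(2 * Real.sqrt a) * Real.cosh t) * Real.cosh (0 * t))]
  refine integral_congr_ae (.of_forall fun t => ?_)
  simp only [zero_mul, Real.cosh_zero, mul_one, Real.cosh_abs, exp_neg_sub_div_sqrt_mul_exp ha]
  have := Real.exp_pos t
  field_simp

lemma integral_exp_neg_sub_div {a : ℝ} (ha : 0 < a) :
    ∫ x in Ioi 0, Real.exp (-x - a / x) = 2 * Real.sqrt a * besselK 1 (2 * Real.sqrt a) := by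
  have hs : 0 < Real.sqrt a := Real.sqrt_pos.2 ha
  have hi := integrable_comp_mul_exp hs (integrableOn_exp_neg_sub_div ha)
  simp only [exp_neg_sub_div_sqrt_mul_exp ha] at hi
  rw [integral_Ioi_eq_integral_comp_mul_exp hs]
  simp only [exp_neg_sub_div_sqrt_mul_exp ha]
  -- The substitution leaves the weight `eᵗ`; averaging with its reflection `t ↦ -t` produces the
  -- `cosh t` of `besselK 1`.
  have h2 : ∫ t, Real.sqrt a * Real.exp (-t) * Real.exp (-(2 * Real.sqrt a) * Real.cosh t) =
      ∫ t, Real.sqrt a * Real.exp t * Real.exp (-(2 * Real.sqrt a) * Real.cosh t) := by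
    rw [← integral_neg_eq_self]
    simp
  have hi2 := hi.comp_neg
  simp only [Real.cosh_neg] at hi2
  have h3 := integral_add hi hi2
  rw [h2] at h3
  have h4 := integral_comp_abs
    (f := fun t => Real.exp (-(2 * Real.sqrt a) * Real.cosh t) * Real.cosh (1 * t))
  rw [← besselK] at h4
  have h5 : ∫ t, Real.sqrt a * Real.exp t * Real.exp (-(2 * Real.sqrt a) * Real.cosh t) +
      Real.sqrt a * Real.exp (-t) * Real.exp (-(2 * Real.sqrt a) * Real.cosh t) =
      2 * Real.sqrt a * (2 * besselK 1 (2 * Real.sqrt a)) := by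
    rw [← h4, ← integral_const_mul]
    refine integral_congr_ae (.of_forall fun t => ?_)
    simp only [one_mul, Real.cosh_abs]
    rw [show Real.exp (-(2 * Real.sqrt a) * Real.cosh t) * Real.cosh t =
      Real.exp (-(2 * Real.sqrt a) * Real.cosh t) * ((Real.exp t + Real.exp (-t)) / 2) by
        rw [← Real.cosh_eq]]
    ring
  linarith

/-! ### The shape-one `K`-distribution as a product of exponentials -/

lemma kPDF_one (l g : ℝ) :
    kPDF 1 l g = 2 / l * besselK 0 (2 * Real.sqrt (g / l)) := by
  rw [kPDF]
  norm_num [Real.rpow_neg_one]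
  left
  ring

lemma kCDF_one (l g : ℝ) :
    kCDF 1 l g = 1 - 2 * Real.sqrt (g / l) * besselK 1 (2 * Real.sqrt (g / l)) := by
  rw [kCDF, Real.Gamma_one, ← Real.sqrt_eq_rpow, div_one]

lemma kPDF_one_eq_integral {l g : ℝ} (hl : 0 < l) (hg : 0 < g) :
    kPDF 1 l g = l⁻¹ * ∫ x in Ioi 0, Real.exp (-x - g / l / x) / x := by
  rw [kPDF_one, integral_exp_neg_sub_div_div (div_pos hg hl)]
  ring

lemma kPDF_one_nonneg {l g : ℝ} (hl : 0 < l) (hg : 0 < g) : 0 ≤ kPDF 1 l g := by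
  rw [kPDF_one_eq_integral hl hg]
  refine mul_nonneg (inv_pos.2 hl).le (setIntegral_nonneg measurableSet_Ioi fun x hx => ?_)
  exact div_nonneg (Real.exp_pos _).le (le_of_lt hx)

/-- Serves both measurability of the density and the passage from almost everywhere to pointwise
nonnegativity of the mixture. -/
lemma continuousOn_kPDF_one {l : ℝ} (hl : 0 < l) : ContinuousOn (kPDF 1 l) (Ioi 0) := by
  have h : ContinuousOn
      (fun g => l⁻¹ * ∫ x in Ioi 0, Real.exp (-x - g / l / x) / x) (Ioi 0) := by
    refine ContinuousOn.const_mul (fun g hg => ContinuousAt.continuousWithinAt ?_) _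
    have hg' : 0 < g := hg
    refine continuousAt_of_dominated (bound := fun x => Real.exp (-x) * (g / 2 / l)⁻¹)
      (.of_forall fun _ => Measurable.aestronglyMeasurable (by fun_prop)) ?_ ((integrableOn_exp_neg_Ioi 0).mul_const _)
      (.of_forall fun x => by fun_prop)
    filter_upwards [lt_mem_nhds (half_lt_self hg')] with y hy
    filter_upwards [ae_restrict_mem measurableSet_Ioi] with x hx
    have hx' : 0 < x := hx
    rw [Real.norm_eq_abs, abs_of_nonneg (by positivity)]
    exact exp_neg_sub_div_div_le (by positivity) (by gcongr) hx
  exact h.congr fun g hg => kPDF_one_eq_integral hl hg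

/-- The integrand is the density of a standard exponential `X` at `x` times that of `l x Y` at `g`,
with `Y` standard exponential. -/
lemma ofReal_kPDF_one {l g : ℝ} (hl : 0 < l) (hg : 0 < g) :
    ENNReal.ofReal (kPDF 1 l g) =
      ∫⁻ x in Ioi (0 : ℝ), ENNReal.ofReal (Real.exp (-x) * (Real.exp (-(g / (l * x))) / (l * x))) := by
  rw [kPDF_one_eq_integral hl hg, ← integral_const_mul, ofReal_integral_eq_lintegral_ofReal
    ((integrableOn_exp_neg_sub_div_div (div_pos hg hl)).const_mul _)]
  · refine setLIntegral_congr_fun measurableSet_Ioi fun x hx => ?_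
    have hx' : 0 < x := hx
    rw [sub_eq_add_neg, Real.exp_add, div_div]
    congr 1
    field_simp
  · filter_upwards [ae_restrict_mem measurableSet_Ioi] with x hx
    have hx' : 0 < x := hx
    simp only [Pi.zero_apply]
    positivity

lemma lintegral_Ioi_comp_mul_left {c : ℝ} (hc : 0 < c) (f : ℝ → ENNReal) :
    ∫⁻ x in Ioi (0 : ℝ), f x = ∫⁻ y in Ioi (0 : ℝ), ENNReal.ofReal c * f (c * y) := by
  have him : (fun y => c * y) '' Ioi (0 : ℝ) = Ioi 0 := by
    rw [Set.image_mul_left_Ioi hc, mul_zero]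
  conv_lhs => rw [← him]
  rw [lintegral_image_eq_lintegral_abs_deriv_mul measurableSet_Ioi
    (fun x _ => ((hasDerivAt_id' x).const_mul c).hasDerivWithinAt)
    (fun _ _ _ _ h => mul_left_cancel₀ hc.ne' h)]
  simp [abs_of_pos hc]

lemma map_prod_stdExp {l : ℝ} (hl : 0 < l) :
    (stdExp.prod stdExp).map (fun p => l * (p.1 * p.2)) = kDistribution 1 l := by
  refine Measure.ext_of_lintegral _ fun f hf => ?_
  have hinner : ∀ x ∈ Ioi (0 : ℝ), ENNReal.ofReal (Real.exp (-x)) *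
      ∫⁻ y, f (l * (x * y)) ∂stdExp = ∫⁻ g in Ioi (0 : ℝ),
        ENNReal.ofReal (Real.exp (-x) * (Real.exp (-(g / (l * x))) / (l * x))) * f g := by
    intro x hx
    have hx' : 0 < x := hx
    rw [lintegral_stdExp (by fun_prop), ← lintegral_const_mul _ (by fun_prop),
      lintegral_Ioi_comp_mul_left (mul_pos hl hx') (fun g =>
        ENNReal.ofReal (Real.exp (-x) * (Real.exp (-(g / (l * x))) / (l * x))) * f g)]
    refine setLIntegral_congr_fun measurableSet_Ioi fun y _ => ?_
    rw [← mul_assoc l x y, ← mul_assoc, ← mul_assoc, ← ENNReal.ofReal_mul (by positivity),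
      ← ENNReal.ofReal_mul (by positivity)]
    congr 2
    field_simp
  rw [lintegral_map hf (by fun_prop), lintegral_prod _ (by fun_prop),
    lintegral_stdExp (Measurable.lintegral_prod_right (by fun_prop)),
    setLIntegral_congr_fun measurableSet_Ioi hinner, lintegral_lintegral_swap (by fun_prop),
    kDistribution, lintegral_withDensity_eq_lintegral_mul₀]
  · refine setLIntegral_congr_fun measurableSet_Ioi fun g hg => ?_
    rw [Pi.mul_apply, ofReal_kPDF_one hl hg, lintegral_mul_const _ (by fun_prop)]
  · exact ((continuousOn_kPDF_one hl).aemeasurable measurableSet_Ioi).ennreal_ofReal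
  · exact hf.aemeasurable

lemma isProbabilityMeasure_kDistribution_one {l : ℝ} (hl : 0 < l) :
    IsProbabilityMeasure (kDistribution 1 l) := by
  rw [← map_prod_stdExp hl]
  exact Measure.isProbabilityMeasure_map (by fun_prop)

lemma stdExp_Ioi {c : ℝ} (hc : 0 ≤ c) : stdExp (Ioi c) = ENNReal.ofReal (Real.exp (-c)) := by
  rw [stdExp, withDensity_apply _ measurableSet_Ioi, Measure.restrict_restrict measurableSet_Ioi,
    Ioi_inter_Ioi, sup_of_le_left hc, ← integral_exp_neg_Ioi c, ofReal_integral_eq_lintegral_ofReal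
    (integrableOn_exp_neg_Ioi c) (.of_forall fun x => (Real.exp_pos _).le)]

/-- Given `X = x`, the event `l X Y > g` is `Y > g / (l x)`, of probability `exp (-g / (l x))`. -/
lemma kDistribution_one_Ioi {l g : ℝ} (hl : 0 < l) (hg : 0 < g) :
    kDistribution 1 l (Ioi g) = ENNReal.ofReal (∫ x in Ioi 0, Real.exp (-x - g / l / x)) := by
  have hm : MeasurableSet ((fun p : ℝ × ℝ => l * (p.1 * p.2)) ⁻¹' Ioi g) :=
    measurableSet_Ioi.preimage (by fun_prop)
  rw [← map_prod_stdExp hl, Measure.map_apply (by fun_prop) measurableSet_Ioi,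
    Measure.prod_apply hm, lintegral_stdExp (measurable_measure_prodMk_left hm),
    ofReal_integral_eq_lintegral_ofReal (integrableOn_exp_neg_sub_div (div_pos hg hl))
      (.of_forall fun x => (Real.exp_pos _).le)]
  refine setLIntegral_congr_fun measurableSet_Ioi fun x hx => ?_
  have hx' : 0 < x := hx
  have hset : Prod.mk x ⁻¹' ((fun p : ℝ × ℝ => l * (p.1 * p.2)) ⁻¹' Ioi g) =
      Ioi (g / l / x) := by
    ext y
    simp only [mem_preimage, mem_Ioi]
    rw [div_div, div_lt_iff₀ (by positivity)]
    ring_nf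
  simp only [hset]
  rw [stdExp_Ioi (by positivity), ← ENNReal.ofReal_mul (by positivity), ← Real.exp_add,
    sub_eq_add_neg]

lemma cdf_kDistribution_one {l g : ℝ} (hl : 0 < l) (hg : 0 < g) :
    cdf (kDistribution 1 l) g = kCDF 1 l g := by
  have := isProbabilityMeasure_kDistribution_one hl
  rw [cdf_eq_real, ← compl_Ioi, probReal_compl_eq_one_sub measurableSet_Ioi, measureReal_def,
    kDistribution_one_Ioi hl hg, ENNReal.toReal_ofReal
      (setIntegral_nonneg measurableSet_Ioi fun x _ => (Real.exp_pos _).le),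
    integral_exp_neg_sub_div (div_pos hg hl), kCDF_one]

/-! ### Eigenvalue bookkeeping and assembly -/

lemma prod_eigenvalues_eq {ι : Type*} [Fintype ι] [DecidableEq ι] {C : Matrix ι ι ℂ}
    (hC : C.IsHermitian) (hd : ∀ j, 0 ≤ hC.eigenvalues j) {q : ℕ} {lam : Fin q → ℝ}
    (hinj : Function.Injective lam)
    (hlam : ∀ x : ℝ, x ∈ range lam ↔
      0 < x ∧ Module.End.HasEigenvalue (Matrix.toLin' C) (x : ℂ))
    (hsimple : ∀ i, eigenMultiplicity C (lam i) = 1) {M : Type*} [CommMonoid M]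
    {f : ℝ → M} (hf : f 0 = 1) :
    ∏ j, f (hC.eigenvalues j) = ∏ i, f (lam i) := by
  have hmem (j) : (hC.eigenvectorBasis j : ι → ℂ) ∈
      Module.End.eigenspace (Matrix.toLin' C) (hC.eigenvalues j : ℂ) := by
    rw [Module.End.mem_eigenspace_iff, Matrix.toLin'_apply, hC.mulVec_eigenvectorBasis]
    rfl
  have hne (j) : (hC.eigenvectorBasis j : ι → ℂ) ≠ 0 := fun h =>
    hC.eigenvectorBasis.orthonormal.ne_zero j (PiLp.ext fun i => congrFun h i)
  -- Each `lam i` occupies exactly one index `e i`: a one-dimensional eigenspace cannot hold two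
  -- orthonormal vectors.
  have hex (i) : ∃ j, hC.eigenvalues j = lam i := by
    have h := ((hlam (lam i)).1 ⟨i, rfl⟩).2.mem_spectrum
    rw [Matrix.spectrum_toLin', hC.spectrum_eq_image_range] at h
    obtain ⟨_, ⟨j, rfl⟩, hj⟩ := h
    exact ⟨j, Complex.ofReal_injective hj⟩
  choose e he using hex
  have huniq (i) (j) (hj : hC.eigenvalues j = lam i) : e i = j := by
    by_contra hij
    have h1 := hmem (e i)
    have h2 := hmem j
    rw [he] at h1
    rw [hj] at h2
    obtain ⟨c, hc⟩ := (finrank_eq_one_iff_of_nonzero' (⟨_, h1⟩ : Module.End.eigenspace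
      (Matrix.toLin' C) (lam i : ℂ)) (fun h => hne _ (congrArg Subtype.val h))).1 (hsimple i)
      ⟨_, h2⟩
    have hc' : c • hC.eigenvectorBasis (e i) = hC.eigenvectorBasis j :=
      PiLp.ext fun k => congrFun (congrArg Subtype.val hc) k
    have ho : inner ℂ (hC.eigenvectorBasis j) (hC.eigenvectorBasis (e i)) = 0 :=
      hC.eigenvectorBasis.orthonormal.2 (Ne.symm hij)
    have hn := hC.eigenvectorBasis.orthonormal.1 j
    have h0 : inner ℂ (hC.eigenvectorBasis j) (hC.eigenvectorBasis j) = 0 := by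
      calc inner ℂ (hC.eigenvectorBasis j) (hC.eigenvectorBasis j)
          = inner ℂ (hC.eigenvectorBasis j) (c • hC.eigenvectorBasis (e i)) := by rw [hc']
        _ = 0 := by rw [inner_smul_right, ho, mul_zero]
    rw [inner_self_eq_zero] at h0
    simp [h0] at hn
  symm
  refine Finset.prod_of_injOn e (fun i _ i' _ h => hinj (by rw [← he, ← he, h]))
    (fun _ _ => Finset.mem_coe.2 (Finset.mem_univ _)) (fun j _ hj => ?_) (fun i _ => by rw [he])
  -- Off the image of `e` only the eigenvalue zero remains, and there `f 0 = 1`.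
  rcases (hd j).eq_or_lt with h | h
  · rw [← h, hf]
  · obtain ⟨i, hi⟩ := (hlam (hC.eigenvalues j)).2
      ⟨h, Module.End.hasEigenvalue_of_hasEigenvector ⟨hmem j, hne j⟩⟩
    exact absurd ⟨i, by simp, huniq i j hi.symm⟩ hj

lemma map_normSq_scaled_product {l : ℝ} (hl : 0 < l) :
    ((complexGaussian.prod complexGaussian).map
      (fun p => (Real.sqrt l : ℂ) * (p.1 * p.2))).map (fun z => ‖z‖ ^ 2) = kDistribution 1 l := by
  have h : (fun z : ℂ => ‖z‖ ^ 2) ∘ (fun p : ℂ × ℂ => (Real.sqrt l : ℂ) * (p.1 * p.2)) =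
      (fun p : ℝ × ℝ => l * (p.1 * p.2)) ∘
        Prod.map (fun z : ℂ => ‖z‖ ^ 2) (fun z : ℂ => ‖z‖ ^ 2) := by
    funext p
    simp [mul_pow, Real.sq_sqrt hl.le]
  rw [Measure.map_map (by fun_prop) (by fun_prop), h, ← Measure.map_map (by fun_prop)
    (by fun_prop), ← Measure.map_prod_map _ _ (by fun_prop) (by fun_prop),
    map_normSq_complexGaussian, map_prod_stdExp hl]

lemma map_channelGain_real {ι : Type*} [Fintype ι] [DecidableEq ι] {A : Matrix ι ι ℂ}
    {q : ℕ} (hq : 0 < q) {lam : Fin q → ℝ} (hinj : Function.Injective lam)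
    (hlam : ∀ x : ℝ, x ∈ range lam ↔
      0 < x ∧ Module.End.HasEigenvalue (Matrix.toLin' (A * Aᴴ)) (x : ℂ))
    (hsimple : ∀ i, eigenMultiplicity (A * Aᴴ) (lam i) = 1) {s : Set ℝ} (hs : MeasurableSet s) :
    (((complexGaussianVec ι).prod (complexGaussianVec ι)).map
      (fun p => channelGain A p.1 p.2)).real s =
      ∑ i, mixWeight lam i * (kDistribution 1 (lam i)).real s := by
  have hpos (i) : 0 < lam i := ((hlam _).1 ⟨i, rfl⟩).1
  have hC : (A * Aᴴ).IsHermitian := Matrix.isHermitian_mul_conjTranspose_self A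
  have hd (j) : 0 ≤ hC.eigenvalues j :=
    (Matrix.posSemidef_self_mul_conjTranspose A).eigenvalues_nonneg j
  have hm := (continuous_bilinear A).measurable
  have hn : Measurable (fun z : ℂ => ‖z‖ ^ 2) := by fun_prop
  have : IsProbabilityMeasure (((complexGaussianVec ι).prod (complexGaussianVec ι)).map
      (fun p => star p.1 ⬝ᵥ (A *ᵥ p.2))) := Measure.isProbabilityMeasure_map hm.aemeasurable
  have hmix := measureReal_eq_of_charFun_eq_sum (μ := ((complexGaussianVec ι).prod
      (complexGaussianVec ι)).map (fun p => star p.1 ⬝ᵥ (A *ᵥ p.2)))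
    (ν := fun i => (complexGaussian.prod complexGaussian).map
      (fun p => (Real.sqrt (lam i) : ℂ) * (p.1 * p.2))) (c := mixWeight lam) (fun t => by
      rw [charFun_bilinear hC hd]
      simp_rw [charFun_scaled_product (hpos _)]
      rw [prod_eigenvalues_eq hC hd hinj hlam hsimple
        (f := fun x => (1 / (1 + (‖t‖ ^ 2 / 4 * x : ℝ)) : ℂ)) (by simp)]
      exact_mod_cast prod_one_div_eq_sum hq hinj hpos (x := ‖t‖ ^ 2 / 4) (by positivity))
    ((fun z : ℂ => ‖z‖ ^ 2) ⁻¹' s)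
  simp_rw [← map_normSq_scaled_product (hpos _), map_measureReal_apply hn hs]
  rw [← hmix, ← map_measureReal_apply hn hs, Measure.map_map hn hm]
  rfl

lemma kDistribution_one_real {l : ℝ} (hl : 0 < l) {s : Set ℝ} (hs : MeasurableSet s) :
    IntegrableOn (kPDF 1 l) (Ioi 0) ∧
      (kDistribution 1 l).real s = ∫ g in s ∩ Ioi 0, kPDF 1 l g := by
  have hprob := isProbabilityMeasure_kDistribution_one hl
  have hnn : 0 ≤ᵐ[volume.restrict (Ioi 0)] kPDF 1 l := by
    filter_upwards [ae_restrict_mem measurableSet_Ioi] with g hg using kPDF_one_nonneg hl hg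
  have hm : AEStronglyMeasurable (kPDF 1 l) (volume.restrict (Ioi 0)) :=
    (continuousOn_kPDF_one hl).aestronglyMeasurable measurableSet_Ioi
  have hi : IntegrableOn (kPDF 1 l) (Ioi 0) := by
    refine ⟨hm, ?_⟩
    rw [hasFiniteIntegral_iff_ofReal hnn, ← setLIntegral_univ, ← withDensity_apply _ .univ]
    exact measure_lt_top (kDistribution 1 l) _
  refine ⟨hi, ?_⟩
  rw [measureReal_def, kDistribution, withDensity_apply _ hs, Measure.restrict_restrict hs,
    integral_eq_lintegral_of_nonneg_ae]
  · exact ae_mono (Measure.restrict_mono inter_subset_right le_rfl) hnn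
  · exact hm.mono_measure (Measure.restrict_mono inter_subset_right le_rfl)

/-- A measure on `ℝ` that is a signed mixture of shape-one `K`-distributions has the mixed density,
which is nonnegative. -/
lemma density_of_mixture {κ : Type*} [Fintype κ] {μ : Measure ℝ} [IsFiniteMeasure μ]
    {lam c : κ → ℝ} (hpos : ∀ i, 0 < lam i)
    (h : ∀ s, MeasurableSet s → μ.real s = ∑ i, c i * (kDistribution 1 (lam i)).real s) :
    (∀ g, 0 < g → 0 ≤ ∑ i, c i * kPDF 1 (lam i) g) ∧
      μ = (volume.restrict (Ioi 0)).withDensity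
        (fun g => ENNReal.ofReal (∑ i, c i * kPDF 1 (lam i) g)) := by
  have hint (i) : IntegrableOn (fun g => c i * kPDF 1 (lam i) g) (Ioi 0) :=
    (kDistribution_one_real (hpos i) MeasurableSet.univ).1.const_mul _
  have hreal (s) (hs : MeasurableSet s) :
      μ.real s = ∫ g in s, ∑ i, c i * kPDF 1 (lam i) g ∂(volume.restrict (Ioi 0)) := by
    rw [h s hs, Measure.restrict_restrict hs, integral_finsetSum _ fun i _ =>
      (hint i).mono_set inter_subset_right]
    refine Finset.sum_congr rfl fun i _ => ?_
    rw [integral_const_mul, (kDistribution_one_real (hpos i) hs).2]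
  have hsum : Integrable (fun g => ∑ i, c i * kPDF 1 (lam i) g) (volume.restrict (Ioi 0)) :=
    integrable_finsetSum _ fun i _ => hint i
  have hae : 0 ≤ᵐ[volume.restrict (Ioi 0)] fun g => ∑ i, c i * kPDF 1 (lam i) g :=
    -- The set integrals are values of the positive measure `μ`, so signed weights cannot make the
    -- density negative on a set of positive measure.
    ae_nonneg_of_forall_setIntegral_nonneg hsum fun s hs _ => by
      rw [← hreal s hs]
      exact measureReal_nonneg
  have hcont : ContinuousOn (fun g => ∑ i, c i * kPDF 1 (lam i) g) (Ioi 0) :=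
    continuousOn_finsetSum _ fun i _ => (continuousOn_kPDF_one (hpos i)).const_mul _
  constructor
  · intro g hg
    by_contra hlt
    push Not at hlt
    -- By continuity, one negative value would give a nonempty open set of them, which has positive
    -- Lebesgue measure.
    have hopen : IsOpen (Ioi 0 ∩ (fun g => ∑ i, c i * kPDF 1 (lam i) g) ⁻¹' Iio 0) :=
      hcont.isOpen_inter_preimage isOpen_Ioi isOpen_Iio
    refine (hopen.measure_pos volume ⟨g, hg, hlt⟩).ne' ?_
    rw [Filter.EventuallyLE, ae_restrict_iff' measurableSet_Ioi, ae_iff] at hae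
    refine measure_mono_null (fun x hx => ?_) hae
    simpa using hx
  · ext s hs
    rw [withDensity_apply _ hs, ← ofReal_integral_eq_lintegral_ofReal hsum.integrableOn
      (ae_restrict_of_ae hae), ← hreal s hs, ofReal_measureReal]

theorem corollary1 {Ω : Type*} [MeasurableSpace Ω] (P : Measure Ω) [IsProbabilityMeasure P]
    {ι : Type*} [Fintype ι] [DecidableEq ι]
    (R : Matrix ι ι ℂ) (hR : R.PosSemidef) (θ : ι → ℝ)
    (gu gf : Ω → ι → ℂ)
    (hgu : HasLaw gu (complexGaussianVec ι) P) (hgf : HasLaw gf (complexGaussianVec ι) P)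
    (hindep : IndepFun gu gf P)
    (q : ℕ) (hq : 0 < q) (lam : Fin q → ℝ) (hinj : Function.Injective lam)
    -- `lam` lists the distinct strictly positive eigenvalues of `C`
    (hlam : ∀ x : ℝ, x ∈ range lam ↔
      0 < x ∧ Module.End.HasEigenvalue (Matrix.toLin' (compositeMatrix R θ)) (x : ℂ))
    (hsimple : ∀ i, eigenMultiplicity (compositeMatrix R θ) (lam i) = 1)
    (G₀ : Ω → ℝ) (hG₀ : ∀ ω, G₀ ω = channelGain (couplingMatrix R θ) (gu ω) (gf ω)) :
    -- the weights sum to one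
    (∑ i, mixWeight lam i = 1) ∧
    -- the components are the shape-one `K`-distributions, with these densities and CDFs
    (∀ i, IsProbabilityMeasure (kDistribution 1 (lam i)) ∧
      (∀ g : ℝ, 0 < g →
        kPDF 1 (lam i) g = 2 / lam i * besselK 0 (2 * Real.sqrt (g / lam i))) ∧
      (∀ g : ℝ, 0 < g → cdf (kDistribution 1 (lam i)) g = kCDF 1 (lam i) g) ∧
      (∀ g : ℝ, 0 < g →
        kCDF 1 (lam i) g =
          1 - 2 * Real.sqrt (g / lam i) * besselK 1 (2 * Real.sqrt (g / lam i)))) ∧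
    -- the law of `G₀` is the mixture of these components
    (∀ s : Set ℝ, MeasurableSet s →
      (P.map G₀).real s = ∑ i, mixWeight lam i * (kDistribution 1 (lam i)).real s) ∧
    -- the density of `G₀`
    (∀ g : ℝ, 0 < g → 0 ≤ ∑ i, mixWeight lam i * kPDF 1 (lam i) g) ∧
    (P.map G₀ = (volume.restrict (Ioi 0)).withDensity
      (fun g => ENNReal.ofReal (∑ i, mixWeight lam i * kPDF 1 (lam i) g))) ∧
    -- the distribution function of `G₀`
    (∀ g : ℝ, 0 < g → cdf (P.map G₀) g = ∑ i, mixWeight lam i * kCDF 1 (lam i) g) ∧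
    (∀ g : ℝ, g ≤ 0 → cdf (P.map G₀) g = 0) := by
  have hpos (i) : 0 < lam i := ((hlam _).1 ⟨i, rfl⟩).1
  have hprob (i) := isProbabilityMeasure_kDistribution_one (hpos i)
  have hm : Measurable (fun p : (ι → ℂ) × (ι → ℂ) => channelGain (couplingMatrix R θ) p.1 p.2) :=
    ((continuous_bilinear (couplingMatrix R θ)).norm.pow 2).measurable
  have hlaw : P.map G₀ = ((complexGaussianVec ι).prod (complexGaussianVec ι)).map
      (fun p => channelGain (couplingMatrix R θ) p.1 p.2) := by
    have hpair := hindep.map_prod_eq_prod_map_map hgu.aemeasurable hgf.aemeasurable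
    rw [hgu.map_eq, hgf.map_eq] at hpair
    rw [← hpair,
      AEMeasurable.map_map_of_aemeasurable hm.aemeasurable
        (hgu.aemeasurable.prodMk hgf.aemeasurable), funext hG₀]
    rfl
  have hmix (s : Set ℝ) (hs : MeasurableSet s) :
      (P.map G₀).real s = ∑ i, mixWeight lam i * (kDistribution 1 (lam i)).real s := by
    rw [hlaw]
    exact map_channelGain_real hq hinj hlam hsimple hs
  have hPG : IsProbabilityMeasure (P.map G₀) := by
    rw [hlaw]
    exact Measure.isProbabilityMeasure_map hm.aemeasurable
  obtain ⟨hnn, hdens⟩ := density_of_mixture hpos hmix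
  refine ⟨by simpa using sum_weight_mul_prod hq hinj hpos 0, fun i => ⟨hprob i,
    fun g _ => kPDF_one _ g, fun g hg => cdf_kDistribution_one (hpos i) hg,
    fun g _ => kCDF_one _ g⟩, hmix, hnn, hdens, fun g hg => ?_, fun g hg => ?_⟩
  · rw [cdf_eq_real, hmix _ measurableSet_Iic]
    simp_rw [← cdf_kDistribution_one (hpos _) hg, cdf_eq_real]
  · rw [cdf_eq_real, measureReal_def, hdens, withDensity_apply _ measurableSet_Iic,
      Measure.restrict_restrict measurableSet_Iic, Iic_inter_Ioi, Ioc_eq_empty (not_lt.2 hg)]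
    simp
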